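/- Let $m\ge 2$ and $k\ge 0$ be integers. Write $$\zeta(m,\{1\}_k)=\sum_{n_1>n_2>\cdots>n_{k+1}\ge 1}\frac{1}{n_1^{m}\,n_2\cdots n_{k+1}}$$ for the multiple zeta value with $k$ ones. This series converges, and its value is a polynomial with rational coefficients in values of the Riemann zeta function $\zeta$ at integers $\ge 2$, given explicitly by $$\zeta(m,\{1\}_k)=\sum_{p=1}^{m-1}\frac{(-1)^{p+1}}{p!}\sum_{\substack{t_1,\dots,t_p\ge 2\\ t_1+\cdots+t_p=m+k}}\frac{H_{m-1}(t_1,\dots,t_p)}{t_1\cdots t_p}\,\zeta(t_1)\cdots\zeta(t_p),$$ where $$H_{l}(t_1,\dots,t_p)=\sum_{\substack{1\le l_i\le t_i-1\ (1\le i\le p)\\ l_1+\cdots+l_p=l}}\binom{t_1}{l_1}\cdots\binom{t_p}{l_p},$$ and both inner sums run over ordered $p$-tuples of integers. -/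

import Mathlib

namespace ZetaTriangle

/-- The summation range of a multiple zeta value of depth `d`:
tuples of integers `n₁ > n₂ > ⋯ > n_d ≥ 1`. -/
abbrev DecreasingTuple (d : ℕ) : Type :=
  {n : Fin d → ℕ // StrictAnti n ∧ ∀ i, 1 ≤ n i}

/-- The general term `1 / (n₁ ^ s₁ ⋯ n_d ^ s_d)` of the multiple zeta series. -/
noncomputable def multiZetaTerm {d : ℕ} (s : Fin d → ℕ) (n : DecreasingTuple d) : ℝ :=
  1 / ∏ i, (n.1 i : ℝ) ^ s i

/-- The multiple zeta value `ζ(s₁, …, s_d)`, the sum of `multiZetaTerm s` over all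
decreasing tuples of positive integers. -/
noncomputable def multiZeta {d : ℕ} (s : Fin d → ℕ) : ℝ :=
  ∑' n : DecreasingTuple d, multiZetaTerm s n

/-- The index `(m, {1}_k) = (m, 1, …, 1)` with `k` ones. -/
def hookIndex (m k : ℕ) : Fin (k + 1) → ℕ :=
  Fin.cons m (fun _ : Fin k => 1)

/-- `H_l(t₁, …, t_p) = ∑ C(t₁, l₁) ⋯ C(t_p, l_p)`, over all ordered tuples of integers
with `1 ≤ l_i ≤ t_i - 1` and `l₁ + ⋯ + l_p = l`. -/
def binomSum (l : ℕ) {p : ℕ} (t : Fin p → ℕ) : ℕ :=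
  ∑ v ∈ ((Finset.univ : Finset (Fin p)).piAntidiag l).filter
      (fun v => ∀ i, 1 ≤ v i ∧ v i < t i),
    ∏ i, (t i).choose (v i)

/-- The ordered tuples of integers `(t₁, …, t_p)` with `t_i ≥ 2` and `t₁ + ⋯ + t_p = N`. -/
def weightTuples (p N : ℕ) : Finset (Fin p → ℕ) :=
  ((Finset.univ : Finset (Fin p)).piAntidiag N).filter (fun t => ∀ i, 2 ≤ t i)

/-- The polynomial, with rational coefficients and variables `X_n`,
`∑_{p=1}^{m-1} (-1)^{p+1} / p! ∑_t H_{m-1}(t) / (t₁ ⋯ t_p) X_{t₁} ⋯ X_{t_p}`,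
the inner sum being over the tuples with `t_i ≥ 2` and `t₁ + ⋯ + t_p = m + k`. -/
noncomputable def zetaPolynomial (m k : ℕ) : MvPolynomial ℕ ℚ :=
  ∑ p ∈ Finset.Icc 1 (m - 1),
    MvPolynomial.C ((-1 : ℚ) ^ (p + 1) / (p.factorial : ℚ)) *
      ∑ t ∈ weightTuples p (m + k),
        MvPolynomial.C ((binomSum (m - 1) t : ℚ) / ∏ i, (t i : ℚ)) *
          ∏ i, MvPolynomial.X (t i)

end ZetaTriangle

namespace ZetaTriangle

open PowerSeries Filter Topology
open scoped PowerSeries.WithPiTopology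

/-! Put all weights into one generating series. For a real parameter `l`, the series ₂F₁(-lX, X; 1 -
lX; 1), read as a formal power series in `X`, equals 1 - ∑ ζ(i+2, {1}_k) l^(i+1) X^(i+k+2): its
terms expand into elementary symmetric functions of 1, 1/2, …, 1/n, which are inner sums of the
multiple zeta series (`coeff_gaussSeries_zero`, `hasSum_multiZetaTerm`).

Gauss' theorem evaluates the same series as Γ(1 - lX) Γ(1 - X) / Γ(1 - (l+1)X), which is exp(-∑_{t ≥
2} ζ(t) ((l+1)^t - l^t - 1) X^t / t) (`gaussSeries_zero_eq_exp`). No Gamma function is needed: a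
contiguity relation raises the lower parameter to N + 1 - lX at the cost of one factor of the
product, and the series tends to 1 as N grows.

Both coefficients of X^w are polynomials in `l`. Comparing them at l^(m-1), with w = m + k, gives
the formula. -/

/-- The linear power series `c - μ X`. -/
noncomputable def linearSeries (c μ : ℝ) : ℝ⟦X⟧ := C c - C μ * X

@[simp]
lemma constantCoeff_linearSeries (c μ : ℝ) : constantCoeff (linearSeries c μ) = c := by
  simp [linearSeries]

lemma linearSeries_mul_inv {c : ℝ} (hc : c ≠ 0) (μ : ℝ) :
    linearSeries c μ * (linearSeries c μ)⁻¹ = 1 :=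
  PowerSeries.mul_inv_cancel _ (by simpa using hc)

lemma linearSeries_ne_zero {c : ℝ} (hc : c ≠ 0) (μ : ℝ) : linearSeries c μ ≠ 0 := fun h =>
  hc (by simpa using congrArg constantCoeff h)

lemma coeff_linearSeries_inv {c : ℝ} (hc : c ≠ 0) (μ : ℝ) (i : ℕ) :
    coeff i (linearSeries c μ)⁻¹ = μ ^ i / c ^ (i + 1) := by
  have h : (linearSeries c μ)⁻¹ = mk fun i => μ ^ i / c ^ (i + 1) := by
    rw [inv_eq_iff_mul_eq_one (by simpa using hc)]
    ext i
    rw [linearSeries, mul_sub, map_sub, mul_comm _ (C c), coeff_C_mul, ← mul_assoc,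
      mul_comm _ (C μ), mul_assoc, coeff_C_mul, coeff_mk]
    cases i with
    | zero => simp [hc]
    | succ i =>
      rw [coeff_succ_mul_X, coeff_mk, coeff_one, if_neg (Nat.succ_ne_zero i)]
      field_simp
      ring
  rw [h, coeff_mk]

/-! ### A truncated weighted `ℓ¹` norm -/

/-- The weighted `ℓ¹` norm of the coefficients of degree at most `w`. -/
noncomputable def truncNorm (w : ℕ) (r : ℝ) (f : ℝ⟦X⟧) : ℝ :=
  ∑ i ∈ Finset.range (w + 1), |coeff i f| * r ^ i

section truncNorm

variable {w : ℕ} {r : ℝ}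

lemma truncNorm_nonneg (hr : 0 ≤ r) (f : ℝ⟦X⟧) : 0 ≤ truncNorm w r f :=
  Finset.sum_nonneg fun _ _ => by positivity

lemma abs_coeff_mul_pow_le_truncNorm (hr : 0 ≤ r) (f : ℝ⟦X⟧) :
    |coeff w f| * r ^ w ≤ truncNorm w r f :=
  Finset.single_le_sum (f := fun i => |coeff i f| * r ^ i) (fun _ _ => by positivity)
    (Finset.self_mem_range_succ w)

lemma truncNorm_add_le (hr : 0 ≤ r) (f g : ℝ⟦X⟧) :
    truncNorm w r (f + g) ≤ truncNorm w r f + truncNorm w r g := by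
  rw [truncNorm, truncNorm, truncNorm, ← Finset.sum_add_distrib]
  refine Finset.sum_le_sum fun i _ => ?_
  rw [← add_mul, map_add]
  gcongr
  exact abs_add_le _ _

/-- Enlarging the pairs of total degree at most `w` to the full square only adds nonnegative terms.
-/
lemma truncNorm_mul_le (hr : 0 ≤ r) (f g : ℝ⟦X⟧) :
    truncNorm w r (f * g) ≤ truncNorm w r f * truncNorm w r g := by
  calc truncNorm w r (f * g)
      ≤ ∑ i ∈ Finset.range (w + 1), ∑ p ∈ Finset.HasAntidiagonal.antidiagonal i,
          (|coeff p.1 f| * r ^ p.1) * (|coeff p.2 g| * r ^ p.2) := by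
        refine Finset.sum_le_sum fun i _ => ?_
        rw [coeff_mul]
        refine (mul_le_mul_of_nonneg_right (Finset.abs_sum_le_sum_abs _ _)
          (by positivity)).trans_eq ?_
        rw [Finset.sum_mul]
        refine Finset.sum_congr rfl fun p hp => ?_
        rw [← Finset.HasAntidiagonal.mem_antidiagonal.1 hp, abs_mul, pow_add]
        ring
    _ ≤ ∑ p ∈ Finset.range (w + 1) ×ˢ Finset.range (w + 1),
          (|coeff p.1 f| * r ^ p.1) * (|coeff p.2 g| * r ^ p.2) := by
        rw [← Finset.sum_biUnion]
        · refine Finset.sum_le_sum_of_subset_of_nonneg ?_ fun _ _ _ => by positivity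
          intro p hp
          simp only [Finset.mem_biUnion, Finset.mem_range, Finset.HasAntidiagonal.mem_antidiagonal,
            Finset.mem_product] at hp ⊢
          lia
        · intro i _ j _ hij
          refine Finset.disjoint_left.2 fun p hp hq => hij ?_
          rw [← Finset.HasAntidiagonal.mem_antidiagonal.1 hp,
            ← Finset.HasAntidiagonal.mem_antidiagonal.1 hq]
    _ = truncNorm w r f * truncNorm w r g := by
        rw [truncNorm, truncNorm, Finset.sum_mul_sum, Finset.sum_product]

lemma truncNorm_C_mul (a : ℝ) (f : ℝ⟦X⟧) :
    truncNorm w r (C a * f) = |a| * truncNorm w r f := by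
  simp [truncNorm, Finset.mul_sum, abs_mul, mul_assoc]

lemma truncNorm_one : truncNorm w r 1 = 1 := by
  simp [truncNorm, coeff_one, Finset.sum_range_succ']

lemma truncNorm_X_le (hr : 0 ≤ r) : truncNorm w r X ≤ r := by
  have : ∀ i ∈ Finset.range (w + 1), |coeff i (X : ℝ⟦X⟧)| * r ^ i = if i = 1 then r else 0 := by
    intro i _
    rw [coeff_X]
    split_ifs with h <;> simp [h]
  rw [truncNorm, Finset.sum_congr rfl this, Finset.sum_ite_eq']
  split_ifs <;> simp [hr]

lemma truncNorm_linearSeries_le (hr : 0 ≤ r) (c μ : ℝ) :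
    truncNorm w r (linearSeries c μ) ≤ |c| + |μ| * r := by
  have : linearSeries c μ = C c * 1 + C (-μ) * X := by simp [linearSeries, sub_eq_add_neg]
  rw [this]
  refine (truncNorm_add_le hr _ _).trans ?_
  rw [truncNorm_C_mul, truncNorm_C_mul, truncNorm_one, abs_neg, mul_one]
  gcongr
  exact truncNorm_X_le hr

/-- The inverse `I` satisfies c I = 1 + μ X I; taking norms and solving for the norm of `I` gives
the bound. -/
lemma truncNorm_linearSeries_inv_le (hr : 0 ≤ r) {c μ : ℝ} (hc : |μ| * r < c) :
    truncNorm w r (linearSeries c μ)⁻¹ ≤ 1 / (c - |μ| * r) := by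
  have hc0 : 0 < c := lt_of_le_of_lt (by positivity) hc
  set I := (linearSeries c μ)⁻¹ with hI
  have h1 : C c * I = 1 + C μ * (X * I) := by
    have := linearSeries_mul_inv hc0.ne' μ
    rw [← hI, linearSeries] at this
    linear_combination this
  have h2 := truncNorm_add_le (w := w) hr 1 (C μ * (X * I))
  rw [← h1, truncNorm_C_mul, truncNorm_C_mul, truncNorm_one, abs_of_pos hc0] at h2
  have h3 : |μ| * truncNorm w r (X * I) ≤ |μ| * (r * truncNorm w r I) := by
    gcongr
    refine (truncNorm_mul_le hr _ _).trans ?_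
    gcongr
    · exact truncNorm_nonneg hr _
    · exact truncNorm_X_le hr
  rw [le_div_iff₀ (by linarith)]
  linarith

end truncNorm

/-! ### The hypergeometric series -/

/-- The term `(-lX)ₙ (X)ₙ / ((N + 1 - lX)ₙ n!)` of Gauss' hypergeometric series. -/
noncomputable def gaussTerm (l : ℝ) (N : ℕ) : ℕ → ℝ⟦X⟧
  | 0 => 1
  | n + 1 => gaussTerm l N n *
      (C ((n + 1 : ℝ)⁻¹) * (linearSeries n l * linearSeries n (-1) *
        (linearSeries (N + 1 + n) l)⁻¹))

/-- The partial product `∏_{j ≤ N} (1 - (l+1)X/j) / ((1 - lX/j)(1 - X/j))`. -/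
noncomputable def gammaProduct (l : ℝ) : ℕ → ℝ⟦X⟧
  | 0 => 1
  | N + 1 => gammaProduct l N * (C (N + 1 : ℝ) * linearSeries (N + 1) (l + 1) *
      ((linearSeries (N + 1) l)⁻¹ * (linearSeries (N + 1) 1)⁻¹))

variable (l : ℝ)

/-- The Pochhammer symbols (N+1-lX)ₙ and (N+2-lX)ₙ share all but their end factors. -/
lemma linearSeries_mul_gaussTerm_succ (N n : ℕ) :
    linearSeries (N + 1 + n) l * gaussTerm l (N + 1) n =
      linearSeries (N + 1) l * gaussTerm l N n := by
  induction n with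
  | zero => simp [gaussTerm]
  | succ n ih =>
    have h1 : ((N + 1 : ℕ) : ℝ) + 1 + n = N + 1 + (n + 1 : ℕ) := by push_cast; ring
    have e1 := linearSeries_mul_inv (c := N + 1 + n) (by positivity) l
    have e2 := linearSeries_mul_inv (c := N + 1 + (n + 1 : ℕ)) (by positivity) l
    rw [gaussTerm, gaussTerm, h1]
    set T := C ((n + 1 : ℝ)⁻¹) * (linearSeries n l * linearSeries n (-1))
    linear_combination (gaussTerm l (N + 1) n * T) * e2 +
      T * (linearSeries (N + 1 + n) l)⁻¹ * ih - gaussTerm l (N + 1) n * T * e1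

/-- Termwise form of the contiguity relation: the right-hand side is a difference in `n`, so it
telescopes on summation. -/
lemma gaussTerm_telescope (N n : ℕ) :
    linearSeries (N + 1) l * linearSeries (N + 1) 1 * gaussTerm l N n -
      C (N + 1 : ℝ) * linearSeries (N + 1) (l + 1) * gaussTerm l (N + 1) n =
    linearSeries (N + 1) l *
      (C (n : ℝ) * gaussTerm l N n - C ((n + 1 : ℕ) : ℝ) * gaussTerm l N (n + 1)) := by
  have h0 : (N + 1 + n : ℝ) ≠ 0 := by positivity
  apply mul_left_cancel₀ (linearSeries_ne_zero h0 l)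
  have h1 := linearSeries_mul_gaussTerm_succ l N n
  have e1 := linearSeries_mul_inv h0 l
  have e2 : C ((n + 1 : ℕ) : ℝ) * C ((n + 1 : ℝ)⁻¹) = (1 : ℝ⟦X⟧) := by
    rw [← map_mul]
    push_cast
    rw [mul_inv_cancel₀ (by positivity), map_one]
  rw [gaussTerm]
  -- The polynomial identity left once the common hypergeometric factor is removed.
  have h2 : linearSeries (N + 1 + n) l * (linearSeries (N + 1) 1) -
      C (N + 1 : ℝ) * linearSeries (N + 1) (l + 1) =
      linearSeries (N + 1 + n) l * C (n : ℝ) - linearSeries n l * linearSeries n (-1) := by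
    simp only [linearSeries, map_add, map_neg, map_one]
    ring
  linear_combination (linearSeries (N + 1) l * gaussTerm l N n) * h2 -
    C (N + 1 : ℝ) * linearSeries (N + 1) (l + 1) * h1 +
    linearSeries (N + 1) l * gaussTerm l N n * linearSeries n l * linearSeries n (-1) *
      (C ((n + 1 : ℕ) : ℝ) * C ((n + 1 : ℝ)⁻¹) * e1 + e2)

/-! ### Uniform bounds for the hypergeometric terms -/

/-- A radius for which the factors of `gaussTerm l N` are close to rational numbers. -/
noncomputable def radius : ℝ := 1 / (16 * (1 + |l|))

lemma radius_pos : 0 < radius l := by unfold radius; positivity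

lemma radius_le : radius l ≤ 1 / 16 := by
  unfold radius
  gcongr
  linarith [abs_nonneg l]

lemma abs_mul_radius_le : |l| * radius l ≤ 1 / 16 := by
  unfold radius
  rw [mul_one_div, div_le_div_iff₀ (by positivity) (by norm_num)]
  linarith [abs_nonneg l]

/-- Successive terms have norm ratio at most (n+e)(n+r)/((n+1)(N+1+n-e)) with e, r ≤ 1/16. The
majorant is summable in `n` uniformly in `N`, and still tends to 0 in `N` for fixed `n`. -/
lemma truncNorm_gaussTerm_succ_le (w N n : ℕ) :
    truncNorm w (radius l) (gaussTerm l N (n + 1)) ≤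
      1 / (√(n + 1 : ℝ) * (N + n + 1)) := by
  have hr := (radius_pos l).le
  have hr1 := radius_le l
  have he1 := abs_mul_radius_le l
  set r := radius l
  set e := |l| * r with he
  have he0 : 0 ≤ e := by positivity
  have bound : ∀ n : ℕ, truncNorm w r (gaussTerm l N (n + 1)) ≤
      truncNorm w r (gaussTerm l N n) *
        ((n + 1 : ℝ)⁻¹ * ((n + e) * (n + r) * (1 / (N + 1 + n - e)))) := by
    intro n
    rw [gaussTerm]
    refine (truncNorm_mul_le hr _ _).trans ?_
    refine mul_le_mul_of_nonneg_left ?_ (truncNorm_nonneg hr _)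
    rw [truncNorm_C_mul, abs_of_pos (by positivity)]
    gcongr
    refine (truncNorm_mul_le hr _ _).trans ?_
    refine mul_le_mul ((truncNorm_mul_le hr _ _).trans ?_)
      (truncNorm_linearSeries_inv_le hr ?_) (truncNorm_nonneg hr _) (by positivity)
    · refine mul_le_mul ((truncNorm_linearSeries_le hr _ _).trans ?_)
        ((truncNorm_linearSeries_le hr _ _).trans ?_) (truncNorm_nonneg hr _) (by positivity)
      · simp [he]
      · simp
    · have : (0 : ℝ) ≤ N + n := by positivity
      linarith
  induction n with
  | zero =>
    refine (bound 0).trans ?_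
    rw [gaussTerm, truncNorm_one]
    have hN : (0 : ℝ) ≤ N := by positivity
    simp only [CharP.cast_eq_zero, zero_add, inv_one, one_mul, add_zero, Real.sqrt_one]
    rw [mul_one_div, div_le_div_iff₀ (by linarith) (by linarith)]
    nlinarith [mul_le_mul he1 hr1 hr (by norm_num)]
  | succ n ih =>
    refine (bound (n + 1)).trans ?_
    have hN : (0 : ℝ) ≤ N := by positivity
    have hn : (0 : ℝ) ≤ n := by positivity
    push_cast
    set x : ℝ := n + 1 with hx
    have hx1 : 1 ≤ x := by linarith
    have hden : 0 < N + 1 + x - e := by linarith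
    -- The square root in the majorant gives up half a power of `x`; the resulting 1/4 absorbs the
    -- perturbations of size 1/16 in `key`.
    have hs : x + 1 / 4 ≤ √x * √(x + 1) := by
      rw [← Real.sqrt_mul (by linarith)]
      refine Real.le_sqrt_of_sq_le ?_
      nlinarith
    have hs0 : 0 < √x := Real.sqrt_pos.2 (by linarith)
    have hs1 : 0 < √(x + 1) := Real.sqrt_pos.2 (by linarith)
    have key : (x + e) * (x + r) * (N + x + 1) ≤ (x + 1 / 4) * ((N + x) * (N + 1 + x - e)) := by
      have h1 : (x + e) * (x + r) ≤ (x + 1 / 16) * (x + 1 / 16) := by gcongr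
      have h2 : (x + 1 / 16) * (x + 1 / 16) * (N + x + 1) ≤
          (x + 1 / 4) * ((N + x) * (N + 1 + x - 1 / 16)) := by
        nlinarith [mul_nonneg hN hN, mul_nonneg hN (by linarith : 0 ≤ x - 1),
          mul_nonneg (mul_nonneg hN hN) (by linarith : 0 ≤ x),
          mul_nonneg (mul_nonneg hN (by linarith : 0 ≤ x)) (by linarith : 0 ≤ x - 1),
          mul_nonneg (by linarith : 0 ≤ x) (by linarith : 0 ≤ x - 1)]
      calc _ ≤ (x + 1 / 16) * (x + 1 / 16) * (N + x + 1) := by gcongr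
        _ ≤ _ := h2
        _ ≤ _ := by gcongr
    calc _ ≤ 1 / (√x * (N + n + 1)) *
          ((x + 1)⁻¹ * ((x + e) * (x + r) * (1 / (N + 1 + x - e)))) := by gcongr
      _ = (x + e) * (x + r) / (√x * (N + x) * (x + 1) * (N + 1 + x - e)) := by
          rw [hx]; field_simp; congr 1; ring
      _ ≤ 1 / (√(x + 1) * (N + x + 1)) := by
          rw [div_le_div_iff₀ (by positivity) (by positivity), one_mul]
          have hsq : √(x + 1) * √(x + 1) = x + 1 := Real.mul_self_sqrt (by linarith)
          calc (x + e) * (x + r) * (√(x + 1) * (N + x + 1))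
              = √(x + 1) * ((x + e) * (x + r) * (N + x + 1)) := by ring
            _ ≤ √(x + 1) * ((√x * √(x + 1)) * ((N + x) * (N + 1 + x - e))) := by
                refine mul_le_mul_of_nonneg_left (key.trans ?_) hs1.le
                have : 0 ≤ N + x := by linarith
                gcongr
            _ = √x * (N + x) * (√(x + 1) * √(x + 1)) * (N + 1 + x - e) := by ring
            _ = _ := by rw [hsq]
      _ ≤ _ := by rw [← add_assoc]

/-- Coefficientwise bound for the terms of the hypergeometric series. -/
lemma abs_coeff_gaussTerm_succ_le (w N n : ℕ) :
    |coeff w (gaussTerm l N (n + 1))| ≤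
      (radius l ^ w)⁻¹ * (1 / (√(n + 1 : ℝ) * (N + n + 1))) := by
  have hr := radius_pos l
  rw [inv_mul_eq_div, le_div_iff₀ (by positivity)]
  exact (abs_coeff_mul_pow_le_truncNorm hr.le _).trans (truncNorm_gaussTerm_succ_le l w N n)

lemma summable_one_div_sqrt_mul : Summable fun n : ℕ => 1 / (√(n + 1 : ℝ) * (n + 1)) := by
  have h := (summable_nat_add_iff 1).2
    (Real.summable_one_div_nat_rpow.2 (by norm_num : (1 : ℝ) < 3 / 2))
  refine h.congr fun n => ?_
  have hn : (0 : ℝ) < n + 1 := by positivity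
  push_cast
  rw [show (3 / 2 : ℝ) = 1 / 2 + 1 by norm_num, Real.rpow_add hn, Real.rpow_one, Real.sqrt_eq_rpow]

lemma abs_coeff_gaussTerm_succ_le' (w N n : ℕ) :
    |coeff w (gaussTerm l N (n + 1))| ≤
      (radius l ^ w)⁻¹ * (1 / (√(n + 1 : ℝ) * (n + 1))) := by
  have hr := radius_pos l
  refine (abs_coeff_gaussTerm_succ_le l w N n).trans ?_
  gcongr
  linarith [(by positivity : (0 : ℝ) ≤ N)]

lemma summable_coeff_gaussTerm_succ (w N : ℕ) :
    Summable fun n => coeff w (gaussTerm l N (n + 1)) :=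
  Summable.of_norm_bounded (summable_one_div_sqrt_mul.mul_left _)
    (abs_coeff_gaussTerm_succ_le' l w N)

lemma summable_gaussTerm (N : ℕ) : Summable (gaussTerm l N) :=
  (WithPiTopology.summable_iff_summable_coeff ..).2 fun w =>
    (summable_nat_add_iff 1).1 (summable_coeff_gaussTerm_succ l w N)

/-! ### Convergence and contiguity of the Gauss series -/

/-- Gauss' hypergeometric series `₂F₁(-lX, X; N + 1 - lX; 1)`. -/
noncomputable def gaussSeries (N : ℕ) : ℝ⟦X⟧ := ∑' n, gaussTerm l N n

lemma hasSum_gaussSeries (N : ℕ) : HasSum (gaussTerm l N) (gaussSeries l N) :=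
  (summable_gaussTerm l N).hasSum

/-- Dominated convergence in each coefficient: only the term n = 0, equal to 1, survives. -/
lemma tendsto_gaussSeries : Tendsto (gaussSeries l) atTop (𝓝 1) := by
  rw [WithPiTopology.tendsto_iff_coeff_tendsto]
  intro w
  have hr := radius_pos l
  have h1 : ∀ N, coeff w (gaussSeries l N) =
      coeff w (1 : ℝ⟦X⟧) + ∑' n, coeff w (gaussTerm l N (n + 1)) := by
    intro N
    have h := (WithPiTopology.hasSum_iff_hasSum_coeff ..).1 (hasSum_gaussSeries l N) w
    rw [← h.tsum_eq, h.summable.tsum_eq_zero_add, gaussTerm]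
  simp_rw [h1]
  have h2 : Tendsto (fun N => ∑' n, coeff w (gaussTerm l N (n + 1))) atTop
      (𝓝 (∑' _ : ℕ, (0 : ℝ))) := by
    refine tendsto_tsum_of_dominated_convergence (summable_one_div_sqrt_mul.mul_left _) ?_
      (Eventually.of_forall fun N n => abs_coeff_gaussTerm_succ_le' l w N n)
    intro n
    refine squeeze_zero_norm (fun N => abs_coeff_gaussTerm_succ_le l w N n) ?_
    have : Tendsto (fun N : ℕ => √(n + 1 : ℝ) * (N + n + 1 : ℝ)) atTop atTop := by
      refine Tendsto.const_mul_atTop (by positivity) ?_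
      exact tendsto_atTop_add_const_right _ _
        (tendsto_atTop_add_const_right _ _ tendsto_natCast_atTop_atTop)
    simpa using ((tendsto_const_nhds (x := (1 : ℝ))).div_atTop this).const_mul ((radius l ^ w)⁻¹)
  simpa using h2.const_add (coeff w (1 : ℝ⟦X⟧))

/-- Makes the boundary term at infinity vanish in the telescoping sum. -/
lemma tendsto_mul_gaussTerm (N : ℕ) :
    Tendsto (fun n : ℕ => C (n : ℝ) * gaussTerm l N n) atTop (𝓝 0) := by
  rw [WithPiTopology.tendsto_iff_coeff_tendsto]
  intro w
  rw [← tendsto_add_atTop_iff_nat 1, map_zero]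
  have hr := radius_pos l
  refine squeeze_zero_norm (a := fun n : ℕ => (radius l ^ w)⁻¹ * (1 / √(n + 1 : ℝ))) ?_ ?_
  · intro n
    rw [coeff_C_mul, norm_mul, Real.norm_eq_abs, Real.norm_eq_abs, Nat.abs_cast]
    refine (mul_le_mul_of_nonneg_left (abs_coeff_gaussTerm_succ_le' l w N n)
      (by positivity)).trans_eq ?_
    push_cast
    field_simp
  · have : Tendsto (fun n : ℕ => √(n + 1 : ℝ)) atTop atTop :=
      Real.tendsto_sqrt_atTop.comp
        (tendsto_atTop_add_const_right _ _ tendsto_natCast_atTop_atTop)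
    simpa using ((tendsto_const_nhds (x := (1 : ℝ))).div_atTop this).const_mul ((radius l ^ w)⁻¹)

lemma gaussSeries_contiguous (N : ℕ) :
    linearSeries (N + 1) 1 * gaussSeries l N =
      C (N + 1 : ℝ) * linearSeries (N + 1) (l + 1) * (linearSeries (N + 1) l)⁻¹ *
        gaussSeries l (N + 1) := by
  have h0 : (N + 1 : ℝ) ≠ 0 := by positivity
  have h1 := ((hasSum_gaussSeries l N).mul_left
    (linearSeries (N + 1) l * linearSeries (N + 1) 1)).sub
    ((hasSum_gaussSeries l (N + 1)).mul_left (C (N + 1 : ℝ) * linearSeries (N + 1) (l + 1)))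
  simp_rw [gaussTerm_telescope] at h1
  have h2 := h1.tendsto_sum_nat
  simp_rw [← Finset.mul_sum,
    Finset.sum_range_sub' (fun n : ℕ => C (n : ℝ) * gaussTerm l N n)] at h2
  have h3 := ((tendsto_mul_gaussTerm l N).const_sub
    (C ((0 : ℕ) : ℝ) * gaussTerm l N 0)).const_mul (linearSeries (N + 1) l)
  have h4 := tendsto_nhds_unique h2 h3
  -- The boundary term at 0 carries the factor n = 0, so both ends vanish.
  simp only [Nat.cast_zero, map_zero, zero_mul, sub_zero, mul_zero] at h4
  have e1 := linearSeries_mul_inv h0 l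
  linear_combination (linearSeries (N + 1) l)⁻¹ * h4 -
    linearSeries (N + 1) 1 * gaussSeries l N * e1

/-- Iterated form of the contiguity relation. -/
lemma gaussSeries_zero_eq (N : ℕ) :
    gaussSeries l 0 = gammaProduct l N * gaussSeries l N := by
  induction N with
  | zero => simp [gammaProduct]
  | succ N ih =>
    have h0 : (N + 1 : ℝ) ≠ 0 := by positivity
    have h := gaussSeries_contiguous l N
    have e1 := linearSeries_mul_inv h0 1
    rw [ih, gammaProduct]
    linear_combination gammaProduct l N * (linearSeries (N + 1) 1)⁻¹ * h -
      gammaProduct l N * gaussSeries l N * e1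

/-! ### The exponential form of Gauss' summation formula -/

/-- The series `∑_{t ≥ 2} a t ((l+1)^t - l^t - 1) X^t / t`. -/
noncomputable def logSeries (l : ℝ) (a : ℕ → ℝ) : ℝ⟦X⟧ :=
  mk fun t => if 2 ≤ t then a t * ((l + 1) ^ t - l ^ t - 1) / t else 0

/-- The truncated zeta value `∑_{n=1}^N 1/n^t`. -/
noncomputable def zetaPartialSum (N t : ℕ) : ℝ := ∑ j ∈ Finset.range N, 1 / (j + 1 : ℝ) ^ t

lemma constantCoeff_logSeries (l : ℝ) (a : ℕ → ℝ) : constantCoeff (logSeries l a) = 0 := by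
  simp [logSeries, ← coeff_zero_eq_constantCoeff_apply]

/-- Geometric expansion of each inverse. The constant term is (l+1) - l - 1 = 0 for every `j`, so
the divergent ζ(1) never enters and `logSeries` may start at t = 2. -/
lemma derivative_logSeries_zetaPartialSum (l : ℝ) (N : ℕ) :
    d⁄dX ℝ (logSeries l (zetaPartialSum N)) = ∑ j ∈ Finset.range N,
      (C (l + 1) * (linearSeries (j + 1) (l + 1))⁻¹ - C l * (linearSeries (j + 1) l)⁻¹ -
        (linearSeries (j + 1) 1)⁻¹) := by
  ext t
  rw [coeff_derivative, logSeries, coeff_mk, map_sum]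
  have h : ∀ j : ℕ, (j + 1 : ℝ) ≠ 0 := fun j => by positivity
  simp_rw [map_sub, coeff_C_mul, coeff_linearSeries_inv (h _)]
  split_ifs with ht
  · have : (t + 1 : ℝ) ≠ 0 := by positivity
    push_cast
    rw [div_mul_cancel₀ _ this, zetaPartialSum, Finset.sum_mul]
    refine Finset.sum_congr rfl fun j _ => ?_
    field_simp
    ring
  · obtain rfl : t = 0 := by lia
    rw [zero_mul, eq_comm]
    refine Finset.sum_eq_zero fun j _ => ?_
    have := h j
    field_simp
    ring

lemma derivative_linearSeries (c μ : ℝ) : d⁄dX ℝ (linearSeries c μ) = -C μ := by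
  simp [linearSeries, Derivation.leibniz]

lemma derivative_gammaProduct (l : ℝ) (N : ℕ) :
    d⁄dX ℝ (gammaProduct l N) =
      -d⁄dX ℝ (logSeries l (zetaPartialSum N)) * gammaProduct l N := by
  rw [derivative_logSeries_zetaPartialSum]
  induction N with
  | zero => simp [gammaProduct]
  | succ N ih =>
    have h0 : (N + 1 : ℝ) ≠ 0 := by positivity
    have e := linearSeries_mul_inv h0 (l + 1)
    rw [gammaProduct, Finset.sum_range_succ]
    simp only [Derivation.leibniz, ih, smul_eq_mul, derivative_inv', derivative_linearSeries,
      derivative_C, map_one]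
    linear_combination (gammaProduct l N * C (N + 1 : ℝ) * (linearSeries (N + 1) l)⁻¹ *
      (linearSeries (N + 1) 1)⁻¹ * C (l + 1)) * e

lemma constantCoeff_gammaProduct (l : ℝ) (N : ℕ) : constantCoeff (gammaProduct l N) = 1 := by
  induction N with
  | zero => simp [gammaProduct]
  | succ N ih =>
    have h0 : (N + 1 : ℝ) ≠ 0 := by positivity
    simp only [gammaProduct, map_mul, ih, constantCoeff_inv, constantCoeff_linearSeries,
      constantCoeff_C]
    field_simp

lemma coeff_exp_subst {V : ℝ⟦X⟧} (hV : constantCoeff V = 0) (w : ℕ) :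
    coeff w ((exp ℝ).subst V) =
      ∑ p ∈ Finset.range (w + 1), (p.factorial : ℝ)⁻¹ * coeff w (V ^ p) := by
  rw [coeff_subst' (HasSubst.of_constantCoeff_zero' hV)]
  rw [finsum_eq_sum_of_support_subset (s := Finset.range (w + 1))]
  · refine Finset.sum_congr rfl fun p _ => ?_
    simp
  · intro p hp
    rw [Finset.coe_range, Set.mem_Iio]
    by_contra! h
    apply hp
    have : coeff w (V ^ p) = 0 := by
      refine coeff_of_lt_order _ (lt_of_lt_of_le ?_ (le_order_pow_of_constantCoeff_eq_zero p hV))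
      exact_mod_cast h
    simp [this]

/-- Both sides solve y' = V' y with constant term 1, so their quotient has zero derivative and is 1.
-/
lemma gammaProduct_eq_exp (l : ℝ) (N : ℕ) :
    gammaProduct l N = (exp ℝ).subst (-logSeries l (zetaPartialSum N)) := by
  set V := -logSeries l (zetaPartialSum N) with hVdef
  have hV : constantCoeff V = 0 := by simp [hVdef, constantCoeff_logSeries]
  set E := (exp ℝ).subst V with hE
  have hE0 : constantCoeff E = 1 := by
    rw [← coeff_zero_eq_constantCoeff_apply, hE, coeff_exp_subst hV]
    simp
  have hE1 : d⁄dX ℝ E = E * d⁄dX ℝ V := by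
    rw [hE, derivative_subst (HasSubst.of_constantCoeff_zero' hV), derivative_exp]
  have hG1 : d⁄dX ℝ (gammaProduct l N) = d⁄dX ℝ V * gammaProduct l N := by
    rw [derivative_gammaProduct, hVdef, map_neg]
  have hEE : E * E⁻¹ = 1 := PowerSeries.mul_inv_cancel _ (by simp [hE0])
  have h : gammaProduct l N * E⁻¹ = 1 := by
    refine derivative.ext (R := ℝ) ?_ ?_
    · rw [Derivation.leibniz, derivative_inv', hE1, hG1, Derivation.map_one_eq_zero]
      simp only [smul_eq_mul]
      linear_combination -(gammaProduct l N * E⁻¹ * d⁄dX ℝ V) * hEE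
    · simp [constantCoeff_gammaProduct, hE0, constantCoeff_inv]
  linear_combination E * h - gammaProduct l N * hEE

lemma tendsto_zetaPartialSum {t : ℕ} (ht : 2 ≤ t) :
    Tendsto (fun N => zetaPartialSum N t) atTop (𝓝 (∑' n : ℕ, 1 / (n + 1 : ℝ) ^ t)) := by
  have h := (summable_nat_add_iff 1).2 (Real.summable_one_div_nat_pow.2 (by lia : 1 < t))
  push_cast at h
  exact h.hasSum.tendsto_sum_nat

/-- The real zeta value at a natural number `t ≥ 2`. -/
noncomputable def realZeta (t : ℕ) : ℝ := ∑' n : ℕ, 1 / (n + 1 : ℝ) ^ t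

lemma tendsto_logSeries (l : ℝ) :
    Tendsto (fun N => logSeries l (zetaPartialSum N)) atTop (𝓝 (logSeries l realZeta)) := by
  rw [WithPiTopology.tendsto_iff_coeff_tendsto]
  intro t
  simp only [logSeries, coeff_mk]
  split_ifs with ht
  · exact ((tendsto_zetaPartialSum ht).mul_const _).div_const _
  · exact tendsto_const_nhds

lemma tendsto_gammaProduct (l : ℝ) :
    Tendsto (gammaProduct l) atTop (𝓝 ((exp ℝ).subst (-logSeries l realZeta))) := by
  rw [WithPiTopology.tendsto_iff_coeff_tendsto]
  intro w
  simp_rw [gammaProduct_eq_exp]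
  have h0 : ∀ a, constantCoeff (-logSeries l a) = 0 := by simp [constantCoeff_logSeries]
  simp_rw [coeff_exp_subst (h0 _)]
  -- Each coefficient of the exponential is a finite sum of coefficients of powers, hence continuous
  -- in the series.
  refine tendsto_finsetSum _ fun p _ => Tendsto.const_mul _ ?_
  exact ((WithPiTopology.continuous_coeff ℝ w).tendsto _).comp ((tendsto_logSeries l).neg.pow p)

/-- Gauss' summation formula, in exponential form. -/
theorem gaussSeries_zero_eq_exp (l : ℝ) :
    gaussSeries l 0 = (exp ℝ).subst (-logSeries l realZeta) := by
  have h := (tendsto_gammaProduct l).mul (tendsto_gaussSeries l)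
  simp_rw [← gaussSeries_zero_eq, mul_one] at h
  exact tendsto_nhds_unique tendsto_const_nhds h

/-! ### Coefficients of the exponential as polynomials in `l` -/

lemma coeff_pow_eq_sum_piAntidiag (f : ℝ⟦X⟧) (p w : ℕ) :
    coeff w (f ^ p) = ∑ t ∈ (Finset.univ : Finset (Fin p)).piAntidiag w,
      ∏ i, coeff (t i) f := by
  have h : f ^ p = ∏ _i : Fin p, f := by simp
  rw [h, coeff_prod]
  refine Finset.sum_bij' (fun t _ => ⇑t) (fun t _ => Finsupp.equivFunOnFinite.symm t) ?_ ?_ ?_ ?_ ?_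
  · intro t ht
    simpa using (Finset.mem_finsuppAntidiag.1 ht).1
  · intro t ht
    simpa using ht
  · intro t _
    ext
    rfl
  · intro t _
    rfl
  · intro t _
    rfl

lemma coeff_neg_logSeries_pow (l : ℝ) (a : ℕ → ℝ) (p w : ℕ) :
    coeff w ((-logSeries l a) ^ p) = (-1) ^ p * ∑ t ∈ weightTuples p w,
      ∏ i, (a (t i) * ((l + 1) ^ t i - l ^ t i - 1) / t i) := by
  rw [coeff_pow_eq_sum_piAntidiag, weightTuples, Finset.sum_filter, Finset.mul_sum]
  refine Finset.sum_congr rfl fun t _ => ?_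
  split_ifs with h
  · rw [show ((-1 : ℝ) ^ p) = ∏ _i : Fin p, (-1 : ℝ) by simp, ← Finset.prod_mul_distrib]
    refine Finset.prod_congr rfl fun i _ => ?_
    simp [logSeries, h i]
  · push Not at h
    obtain ⟨i, hi⟩ := h
    rw [mul_zero]
    exact Finset.prod_eq_zero (Finset.mem_univ i) (by simp [logSeries, hi])

lemma add_one_pow_sub_eq_sum (l : ℝ) {t : ℕ} (ht : 1 ≤ t) :
    (l + 1) ^ t - l ^ t - 1 = ∑ j ∈ Finset.Ico 1 t, (t.choose j : ℝ) * l ^ j := by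
  rw [add_pow, Finset.sum_range_succ, Finset.range_eq_Ico, Finset.sum_eq_sum_Ico_succ_bot ht]
  simp only [one_pow, mul_one, Nat.choose_self, Nat.cast_one, pow_zero, Nat.choose_zero_right,
    zero_add]
  rw [Finset.sum_congr rfl fun j _ => mul_comm (l ^ j) _]
  ring

/-- Removing l^t and 1 from (l+1)^t deletes the extreme binomial terms, whence the condition 1 ≤ l_i
≤ t_i - 1; the expanded product is grouped by total degree. -/
lemma prod_add_one_pow_sub_eq_sum (l : ℝ) {p w : ℕ} {t : Fin p → ℕ} (ht : t ∈ weightTuples p w) :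
    ∏ i, ((l + 1) ^ t i - l ^ t i - 1) =
      ∑ s ∈ Finset.range (w + 1), (binomSum s t : ℝ) * l ^ s := by
  rw [weightTuples, Finset.mem_filter, Finset.mem_piAntidiag] at ht
  obtain ⟨⟨hsum, -⟩, h2⟩ := ht
  rw [Finset.prod_congr rfl fun i _ =>
    add_one_pow_sub_eq_sum l (by linarith [h2 i] : 1 ≤ t i), Finset.prod_univ_sum,
    ← Finset.sum_fiberwise_of_maps_to (t := Finset.range (w + 1)) (g := fun v => ∑ i, v i)]
  · refine Finset.sum_congr rfl fun s _ => ?_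
    rw [binomSum, Nat.cast_sum, Finset.sum_mul]
    refine Finset.sum_congr ?_ fun v hv => ?_
    · ext v
      simp only [Finset.mem_filter, Fintype.mem_piFinset, Finset.mem_Ico, Finset.mem_piAntidiag,
        Finset.mem_univ, implies_true, and_true]
      exact and_comm
    · rw [Finset.mem_filter, Finset.mem_piAntidiag] at hv
      rw [Finset.prod_mul_distrib, Finset.prod_pow_eq_pow_sum, ← hv.1.1, Nat.cast_prod]
  · intro v hv
    rw [Finset.mem_range, Nat.lt_succ_iff, ← hsum]
    exact Finset.sum_le_sum fun i _ => (Finset.mem_Ico.1 (Fintype.mem_piFinset.1 hv i)).2.le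

/-- The coefficient of `x^s y^(w-s)` in `exp (-∑ a t ((x + y)^t - x^t - y^t) / t)`. -/
noncomputable def expCoeff (a : ℕ → ℝ) (w s : ℕ) : ℝ :=
  ∑ p ∈ Finset.range (w + 1), (-1) ^ p / (p.factorial : ℝ) *
    ∑ t ∈ weightTuples p w, (binomSum s t : ℝ) / (∏ i, (t i : ℝ)) * ∏ i, a (t i)

lemma coeff_exp_neg_logSeries (l : ℝ) (a : ℕ → ℝ) (w : ℕ) :
    coeff w ((exp ℝ).subst (-logSeries l a)) =
      ∑ s ∈ Finset.range (w + 1), expCoeff a w s * l ^ s := by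
  rw [coeff_exp_subst (by simp [constantCoeff_logSeries])]
  simp_rw [expCoeff, Finset.sum_mul]
  rw [Finset.sum_comm]
  refine Finset.sum_congr rfl fun p _ => ?_
  rw [coeff_neg_logSeries_pow]
  have h : ∀ t ∈ weightTuples p w, ∏ i, (a (t i) * ((l + 1) ^ t i - l ^ t i - 1) / t i) =
      ∑ s ∈ Finset.range (w + 1),
        (binomSum s t : ℝ) / (∏ i, (t i : ℝ)) * (∏ i, a (t i)) * l ^ s := by
    intro t ht
    rw [Finset.prod_div_distrib, Finset.prod_mul_distrib, prod_add_one_pow_sub_eq_sum l ht,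
      Finset.mul_sum, Finset.sum_div]
    refine Finset.sum_congr rfl fun s _ => ?_
    ring
  rw [Finset.sum_congr rfl h, Finset.sum_comm, Finset.mul_sum, Finset.mul_sum]
  refine Finset.sum_congr rfl fun s _ => ?_
  rw [← Finset.sum_mul]
  ring

/-! ### The coefficients of the hypergeometric series -/

/-- The elementary symmetric polynomial of degree `k` in `1, 1/2, …, 1/n`. -/
noncomputable def harmonicEsymm (n k : ℕ) : ℝ :=
  ∑ S ∈ (Finset.Icc 1 n).powersetCard k, ∏ j ∈ S, (1 / (j : ℝ))

lemma harmonicEsymm_nonneg (n k : ℕ) : 0 ≤ harmonicEsymm n k :=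
  Finset.sum_nonneg fun _ _ => Finset.prod_nonneg fun _ _ => by positivity

lemma coeff_prod_one_add (n k : ℕ) :
    coeff k (∏ j ∈ Finset.Icc 1 n, (1 + C (1 / (j : ℝ)) * X)) = harmonicEsymm n k := by
  rw [Finset.prod_one_add, map_sum, harmonicEsymm, Finset.powersetCard_eq_filter,
    Finset.sum_filter]
  refine Finset.sum_congr rfl fun S _ => ?_
  rw [Finset.prod_mul_distrib, Finset.prod_const, ← map_prod, coeff_C_mul, coeff_X_pow]
  simp [eq_comm]

/-- For N = 0 the symbols (-lX)ₙ₊₁ and (1-lX)ₙ₊₁ cancel except for -lX/(n+1-lX), while (X)ₙ₊₁/(n+1)!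
is X/(n+1) times the product of 1 + X/j. -/
lemma gaussTerm_zero_succ (l : ℝ) (n : ℕ) :
    gaussTerm l 0 (n + 1) = -(X ^ 2 * (C (l / (n + 1)) * ((linearSeries (n + 1) l)⁻¹ *
      ∏ j ∈ Finset.Icc 1 n, (1 + C (1 / (j : ℝ)) * X)))) := by
  induction n with
  | zero =>
    simp [gaussTerm, linearSeries]
    ring
  | succ n ih =>
    have h0 : (n + 1 : ℝ) ≠ 0 := by positivity
    have h1 : (n + 1 + 1 : ℝ) ≠ 0 := by positivity
    have e := linearSeries_mul_inv h0 l
    rw [gaussTerm, ih, Finset.prod_Icc_succ_top (by lia)]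
    have e1 : C (l / (n + 1)) * (C ((n + 1 + 1 : ℝ)⁻¹) * linearSeries (n + 1) (-1)) =
        C (l / (n + 1 + 1)) * (1 + C (1 / (n + 1 : ℝ)) * X) := by
      have e2 : C (n + 1 : ℝ) * C (1 / (n + 1 : ℝ)) = 1 := by
        rw [← map_mul, mul_one_div_cancel h0, map_one]
      have e3 : C (l / (n + 1)) * C ((n + 1 + 1 : ℝ)⁻¹) * C (n + 1 : ℝ) = C (l / (n + 1 + 1)) := by
        rw [← map_mul, ← map_mul]
        congr 1
        field_simp
      rw [linearSeries, map_neg, map_one, ← e3]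
      linear_combination (-C (l / (n + 1)) * C ((n + 1 + 1 : ℝ)⁻¹) * X) * e2
    push_cast
    rw [zero_add, add_comm (1 : ℝ) (n + 1)]
    set P := ∏ j ∈ Finset.Icc 1 n, (1 + C (1 / (j : ℝ)) * X)
    set I := (linearSeries (n + 1) l)⁻¹
    set J := (linearSeries (n + 1 + 1) l)⁻¹
    linear_combination (-X ^ 2 * P * J) * e1 -
      X ^ 2 * P * J * C (l / (n + 1)) * C ((n + 1 + 1 : ℝ)⁻¹) * linearSeries (n + 1) (-1) * e

lemma coeff_gaussTerm_zero_succ (l : ℝ) (n v : ℕ) :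
    coeff (v + 2) (gaussTerm l 0 (n + 1)) =
      -∑ q ∈ Finset.HasAntidiagonal.antidiagonal v,
        l ^ (q.1 + 1) * (harmonicEsymm n q.2 / (n + 1) ^ (q.1 + 2)) := by
  rw [gaussTerm_zero_succ, map_neg, coeff_X_pow_mul, coeff_C_mul, coeff_mul, Finset.mul_sum]
  congr 1
  refine Finset.sum_congr rfl fun q _ => ?_
  have h0 : (n + 1 : ℝ) ≠ 0 := by positivity
  rw [coeff_linearSeries_inv h0, coeff_prod_one_add]
  field_simp
  ring

lemma summable_harmonicEsymm_div (i k : ℕ) :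
    Summable fun n : ℕ => harmonicEsymm n k / (n + 1 : ℝ) ^ (i + 2) := by
  -- At l = 1 the negated coefficient is a sum of nonnegative terms, so it dominates each of them.
  have h := (summable_coeff_gaussTerm_succ 1 (i + k + 2) 0).neg
  simp_rw [coeff_gaussTerm_zero_succ, neg_neg, one_pow, one_mul] at h
  refine Summable.of_nonneg_of_le
    (fun n => div_nonneg (harmonicEsymm_nonneg _ _) (by positivity)) (fun n => ?_) h
  exact Finset.single_le_sum
    (f := fun q : ℕ × ℕ => harmonicEsymm n q.2 / (n + 1 : ℝ) ^ (q.1 + 2)) (a := (i, k))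
    (fun q _ => div_nonneg (harmonicEsymm_nonneg _ _) (by positivity)) (by simp)

lemma coeff_gaussSeries_zero (l : ℝ) (v : ℕ) :
    coeff (v + 2) (gaussSeries l 0) =
      -∑ q ∈ Finset.HasAntidiagonal.antidiagonal v,
        l ^ (q.1 + 1) * ∑' n : ℕ, harmonicEsymm n q.2 / (n + 1 : ℝ) ^ (q.1 + 2) := by
  have h := (WithPiTopology.hasSum_iff_hasSum_coeff ..).1 (hasSum_gaussSeries l 0) (v + 2)
  have h0 : coeff (v + 2) (gaussTerm l 0 0) = 0 := by simp [gaussTerm, coeff_one]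
  have h1 := fun q : ℕ × ℕ => (summable_harmonicEsymm_div q.1 q.2).mul_left (l ^ (q.1 + 1))
  rw [← h.tsum_eq, h.summable.tsum_eq_zero_add, h0, zero_add,
    tsum_congr fun n => coeff_gaussTerm_zero_succ l n v, tsum_neg,
    Summable.tsum_finsetSum fun q _ => h1 q]
  exact congrArg Neg.neg (Finset.sum_congr rfl fun q _ => tsum_mul_left)

/-! ### Decreasing tuples -/

/-- The decreasing tuple with largest entry `n + 1` and the elements of `S` as other entries. -/
noncomputable def consTuple (k : ℕ)
    (x : Σ n : ℕ, {S : Finset ℕ // S ∈ (Finset.Icc 1 n).powersetCard k}) :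
    DecreasingTuple (k + 1) :=
  -- `orderEmbOfFin` enumerates increasingly; `i.rev` makes the tuple decrease.
  ⟨Fin.cons (x.1 + 1) fun i => x.2.1.orderEmbOfFin (Finset.mem_powersetCard.1 x.2.2).2 i.rev, by
    have hmem : ∀ i, x.2.1.orderEmbOfFin (Finset.mem_powersetCard.1 x.2.2).2 i ∈
        Finset.Icc 1 x.1 := fun i =>
      (Finset.mem_powersetCard.1 x.2.2).1 (Finset.orderEmbOfFin_mem _ _ i)
    constructor
    · intro i j hij
      induction i using Fin.cases with
      | zero =>
        induction j using Fin.cases with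
        | zero => exact absurd hij (lt_irrefl _)
        | succ j =>
          simp only [Fin.cons_zero, Fin.cons_succ]
          exact Nat.lt_succ_of_le (Finset.mem_Icc.1 (hmem _)).2
      | succ i =>
        induction j using Fin.cases with
        | zero => exact absurd hij (Fin.not_lt_zero _)
        | succ j =>
          simp only [Fin.cons_succ]
          exact (OrderEmbedding.strictMono _) (Fin.rev_lt_rev.2 (Fin.succ_lt_succ_iff.1 hij))
    · intro i
      induction i using Fin.cases with
      | zero => simp
      | succ i => simpa using (Finset.mem_Icc.1 (hmem i.rev)).1⟩

lemma consTuple_bijective (k : ℕ) : Function.Bijective (consTuple k) := by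
  constructor
  · rintro ⟨n, S, hS⟩ ⟨n', S', hS'⟩ h
    have h1 : (consTuple k ⟨n, S, hS⟩).1 = (consTuple k ⟨n', S', hS'⟩).1 := congrArg Subtype.val h
    obtain rfl : n = n' := by simpa [consTuple] using congrFun h1 0
    have h4 : S = S' := by
      have h5 : S.orderEmbOfFin (Finset.mem_powersetCard.1 hS).2 =
          S'.orderEmbOfFin (Finset.mem_powersetCard.1 hS').2 := by
        ext i
        simpa [consTuple] using congrFun h1 i.rev.succ
      rw [← Finset.coe_inj, ← Finset.range_orderEmbOfFin S (Finset.mem_powersetCard.1 hS).2, h5,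
        Finset.range_orderEmbOfFin]
    subst h4
    rfl
  · rintro ⟨t, ht, ht1⟩
    have hanti : StrictMono fun i : Fin k => t i.rev.succ := fun i j hij =>
      ht (Fin.succ_lt_succ_iff.2 (Fin.rev_lt_rev.2 hij))
    set S : Finset ℕ := Finset.univ.image fun i : Fin k => t i.rev.succ with hSdef
    have hcard : S.card = k := by
      rw [hSdef, Finset.card_image_of_injective _ hanti.injective, Finset.card_univ,
        Fintype.card_fin]
    have hS : S ∈ (Finset.Icc 1 (t 0 - 1)).powersetCard k := by
      refine Finset.mem_powersetCard.2 ⟨fun x hx => ?_, hcard⟩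
      obtain ⟨i, -, rfl⟩ := Finset.mem_image.1 hx
      have := ht (Fin.succ_pos i.rev)
      exact Finset.mem_Icc.2 ⟨ht1 _, by lia⟩
    refine ⟨⟨t 0 - 1, S, hS⟩, Subtype.ext ?_⟩
    have huniq := Finset.orderEmbOfFin_unique hcard
      (fun i => Finset.mem_image_of_mem _ (Finset.mem_univ i)) hanti
    funext i
    induction i using Fin.cases with
    | zero =>
      have := ht1 0
      simp only [consTuple, Fin.cons_zero]
      lia
    | succ i =>
      have := congrFun huniq i.rev
      simpa [consTuple] using this.symm

lemma multiZetaTerm_consTuple (m k : ℕ)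
    (x : Σ n : ℕ, {S : Finset ℕ // S ∈ (Finset.Icc 1 n).powersetCard k}) :
    multiZetaTerm (hookIndex m k) (consTuple k x) =
      (∏ j ∈ x.2.1, (1 / (j : ℝ))) / (x.1 + 1 : ℝ) ^ m := by
  have h : ∏ i : Fin k, ((x.2.1.orderEmbOfFin (Finset.mem_powersetCard.1 x.2.2).2 i.rev : ℕ) : ℝ) =
      ∏ j ∈ x.2.1, (j : ℝ) := by
    refine (Equiv.prod_comp Fin.revPerm fun i =>
      ((x.2.1.orderEmbOfFin (Finset.mem_powersetCard.1 x.2.2).2 i : ℕ) : ℝ)).trans ?_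
    conv_rhs => rw [← Finset.image_orderEmbOfFin_univ x.2.1 (Finset.mem_powersetCard.1 x.2.2).2]
    rw [Finset.prod_image fun i _ j _ h => (RelEmbedding.injective _) h]
  rw [multiZetaTerm, Fin.prod_univ_succ]
  simp only [consTuple, hookIndex, Fin.cons_zero, Fin.cons_succ, pow_one]
  rw [h, Finset.prod_div_distrib, Finset.prod_const_one]
  push_cast
  rw [div_div, mul_comm]

/-- Sum first over the entries below the largest one: each fibre is finite and the terms are
nonnegative, so summability of the fibre sums suffices. -/
lemma hasSum_multiZetaTerm (i k : ℕ) :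
    HasSum (multiZetaTerm (hookIndex (i + 2) k))
      (∑' n : ℕ, harmonicEsymm n k / (n + 1 : ℝ) ^ (i + 2)) := by
  rw [← (Equiv.ofBijective _ (consTuple_bijective k)).hasSum_iff]
  have hfun : multiZetaTerm (hookIndex (i + 2) k) ∘ Equiv.ofBijective _ (consTuple_bijective k) =
      fun x : Σ n : ℕ, {S : Finset ℕ // S ∈ (Finset.Icc 1 n).powersetCard k} =>
        (∏ j ∈ x.2.1, (1 / (j : ℝ))) / (x.1 + 1 : ℝ) ^ (i + 2) :=
    funext fun x => multiZetaTerm_consTuple (i + 2) k x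
  rw [hfun]
  have hfib : ∀ n : ℕ, HasSum
      (fun S : {S : Finset ℕ // S ∈ (Finset.Icc 1 n).powersetCard k} =>
        (∏ j ∈ S.1, (1 / (j : ℝ))) / (n + 1 : ℝ) ^ (i + 2))
      (harmonicEsymm n k / (n + 1 : ℝ) ^ (i + 2)) := by
    intro n
    rw [harmonicEsymm, Finset.sum_div]
    exact Finset.hasSum ((Finset.Icc 1 n).powersetCard k)
      fun S => (∏ j ∈ S, (1 / (j : ℝ))) / (n + 1 : ℝ) ^ (i + 2)
  have hs := summable_harmonicEsymm_div i k
  have hsum : Summable fun x : Σ n : ℕ, {S : Finset ℕ // S ∈ (Finset.Icc 1 n).powersetCard k} =>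
      (∏ j ∈ x.2.1, (1 / (j : ℝ))) / (x.1 + 1 : ℝ) ^ (i + 2) := by
    refine (summable_sigma_of_nonneg fun x => ?_).2 ⟨fun n => (hfib n).summable, ?_⟩
    · exact div_nonneg (Finset.prod_nonneg fun _ _ => by positivity) (by positivity)
    · exact hs.congr fun n => (hfib n).tsum_eq.symm
  rw [(hsum.hasSum.sigma hfib).tsum_eq]
  exact hsum.hasSum

/-! ### Comparison of coefficients -/

lemma sum_multiZeta_hookIndex (l : ℝ) (v : ℕ) :
    ∑ q ∈ Finset.HasAntidiagonal.antidiagonal v,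
        l ^ (q.1 + 1) * multiZeta (hookIndex (q.1 + 2) q.2) =
      -∑ s ∈ Finset.range (v + 2 + 1), expCoeff realZeta (v + 2) s * l ^ s := by
  rw [← coeff_exp_neg_logSeries, ← gaussSeries_zero_eq_exp, coeff_gaussSeries_zero, neg_neg]
  refine Finset.sum_congr rfl fun q _ => ?_
  rw [multiZeta, (hasSum_multiZetaTerm q.1 q.2).tsum_eq]

/-- The two sides of `sum_multiZeta_hookIndex` agree at every real `l`, so they are equal as
polynomials in `l`. -/
lemma multiZeta_hookIndex_eq_neg_expCoeff (i k : ℕ) :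
    multiZeta (hookIndex (i + 2) k) = -expCoeff realZeta (i + k + 2) (i + 1) := by
  have h : ∑ q ∈ Finset.HasAntidiagonal.antidiagonal (i + k),
        Polynomial.monomial (q.1 + 1) (multiZeta (hookIndex (q.1 + 2) q.2)) =
      -∑ s ∈ Finset.range (i + k + 2 + 1),
        Polynomial.monomial s (expCoeff realZeta (i + k + 2) s) := by
    refine Polynomial.funext fun l => ?_
    rw [Polynomial.eval_neg, Polynomial.eval_finsetSum, Polynomial.eval_finsetSum]
    simp_rw [Polynomial.eval_monomial]
    rw [← sum_multiZeta_hookIndex]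
    exact Finset.sum_congr rfl fun q _ => mul_comm _ _
  have h1 := congrArg (fun P => Polynomial.coeff P (i + 1)) h
  simp only [Polynomial.coeff_neg, Polynomial.finsetSum_coeff, Polynomial.coeff_monomial] at h1
  rw [Finset.sum_ite_eq' , if_pos (Finset.mem_range.2 (by lia)),
    Finset.sum_eq_single (i, k)] at h1
  · simpa using h1
  · rintro ⟨a, b⟩ hab hne
    rw [Finset.HasAntidiagonal.mem_antidiagonal] at hab
    refine if_neg fun h2 => hne ?_
    simp only [Prod.mk.injEq] at h2 hab ⊢
    lia
  · intro h2
    simp at h2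

/-! ### The polynomial in Riemann zeta values -/

lemma binomSum_eq_zero {s p : ℕ} (h : s < p) (t : Fin p → ℕ) : binomSum s t = 0 := by
  refine Finset.sum_eq_zero fun v hv => ?_
  rw [Finset.mem_filter, Finset.mem_piAntidiag] at hv
  have h1 : ∑ _i : Fin p, 1 ≤ ∑ i, v i := Finset.sum_le_sum fun i _ => (hv.2 i).1
  rw [hv.1.1] at h1
  simp at h1
  lia

lemma weightTuples_zero {w : ℕ} (hw : w ≠ 0) : weightTuples 0 w = ∅ := by
  simp [weightTuples, hw]

/-- No empty tuple has positive weight, and p parts l_i ≥ 1 cannot sum to s < p; only 1 ≤ p ≤ s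
remains. -/
lemma neg_expCoeff_eq (a : ℕ → ℝ) {w s : ℕ} (hw : w ≠ 0) (hs : s ≤ w) :
    -expCoeff a w s = ∑ p ∈ Finset.Icc 1 s, (-1) ^ (p + 1) / (p.factorial : ℝ) *
      ∑ t ∈ weightTuples p w, (binomSum s t : ℝ) / (∏ i, (t i : ℝ)) * ∏ i, a (t i) := by
  rw [expCoeff, ← Finset.sum_neg_distrib]
  symm
  refine Finset.sum_subset_zero_on_sdiff ?_ ?_ ?_
  · intro p hp
    rw [Finset.mem_Icc] at hp
    exact Finset.mem_range.2 (by lia)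
  · intro p hp
    rw [Finset.mem_sdiff, Finset.mem_range, Finset.mem_Icc] at hp
    rcases Nat.eq_zero_or_pos p with rfl | h0
    · rw [weightTuples_zero hw]
      simp
    · rw [Finset.sum_eq_zero fun t _ => by rw [binomSum_eq_zero (by lia)]; simp]
      simp
  · intro p _
    ring

lemma riemannZeta_natCast {t : ℕ} (ht : 2 ≤ t) : riemannZeta t = (realZeta t : ℂ) := by
  rw [zeta_nat_eq_tsum_of_gt_one (by lia), realZeta, Complex.ofReal_tsum]
  -- The library series starts at n = 0, where 1 / 0^t = 0; that term is split off.
  rw [((Complex.summable_one_div_nat_cpow (p := t)).2 (by simp; lia) |>.congr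
    fun n => by rw [Complex.cpow_natCast]).tsum_eq_zero_add]
  have : t ≠ 0 := by lia
  simp [this]

lemma two_le_of_mem_weightTuples {p w : ℕ} {t : Fin p → ℕ} (ht : t ∈ weightTuples p w)
    (i : Fin p) : 2 ≤ t i := (Finset.mem_filter.1 ht).2 i

lemma aeval_zetaPolynomial (m k : ℕ) :
    MvPolynomial.aeval (fun n : ℕ => riemannZeta (n : ℂ)) (zetaPolynomial m k) =
      ((∑ p ∈ Finset.Icc 1 (m - 1), (-1) ^ (p + 1) / (p.factorial : ℝ) *
        ∑ t ∈ weightTuples p (m + k), (binomSum (m - 1) t : ℝ) / (∏ i, (t i : ℝ)) *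
          ∏ i, realZeta (t i) : ℝ) : ℂ) := by
  rw [zetaPolynomial, map_sum, Complex.ofReal_sum]
  refine Finset.sum_congr rfl fun p _ => ?_
  rw [map_mul, map_sum, Complex.ofReal_mul, Complex.ofReal_sum]
  congr 1
  · simp
  · refine Finset.sum_congr rfl fun t ht => ?_
    rw [map_mul, map_prod, Complex.ofReal_mul, Complex.ofReal_prod]
    congr 1
    · simp
    · refine Finset.prod_congr rfl fun i _ => ?_
      rw [MvPolynomial.aeval_X, riemannZeta_natCast (two_le_of_mem_weightTuples ht i)]

lemma two_le_of_mem_vars_zetaPolynomial (m k : ℕ) : ∀ n ∈ (zetaPolynomial m k).vars, 2 ≤ n := by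
  have h : zetaPolynomial m k ∈ MvPolynomial.supported ℚ {n : ℕ | 2 ≤ n} := by
    refine Subalgebra.sum_mem _ fun p _ => Subalgebra.mul_mem _ (Subalgebra.algebraMap_mem _ _) ?_
    refine Subalgebra.sum_mem _ fun t ht => Subalgebra.mul_mem _ (Subalgebra.algebraMap_mem _ _) ?_
    exact Subalgebra.prod_mem _ fun i _ =>
      MvPolynomial.X_mem_supported.2 (two_le_of_mem_weightTuples ht i)
  exact fun n hn => MvPolynomial.mem_supported.1 h hn

end ZetaTriangle

theorem mainTheorem3 (m k : ℕ) (hm : 2 ≤ m) :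
    Summable (ZetaTriangle.multiZetaTerm (ZetaTriangle.hookIndex m k)) ∧
    (∀ n ∈ (ZetaTriangle.zetaPolynomial m k).vars, 2 ≤ n) ∧
    ((ZetaTriangle.multiZeta (ZetaTriangle.hookIndex m k) : ℝ) : ℂ) =
      MvPolynomial.aeval (fun n : ℕ => riemannZeta (n : ℂ))
        (ZetaTriangle.zetaPolynomial m k) := by
  obtain ⟨i, rfl⟩ := Nat.exists_eq_add_of_le' hm
  refine ⟨(ZetaTriangle.hasSum_multiZetaTerm i k).summable,
    ZetaTriangle.two_le_of_mem_vars_zetaPolynomial _ _, ?_⟩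
  rw [ZetaTriangle.aeval_zetaPolynomial, ZetaTriangle.multiZeta_hookIndex_eq_neg_expCoeff,
    ZetaTriangle.neg_expCoeff_eq _ (by lia) (by lia), add_right_comm i k 2]
  -- The remaining discrepancy, `i + 2 - 1` against `i + 1`, is definitional.
  rfl
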